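/- Theorem 1.4. A function meromorphic in $\mathbb{C}$ is regarded as a map $\mathbb{C} \to \widehat{\mathbb{C}} = \mathbb{C} \cup \{\infty\}$ (not identically $\infty$), extended to the point $\infty$ by its limit in $\widehat{\mathbb{C}}$ there if this limit exists, and undefined at $\infty$ otherwise. It is transcendental if $\infty$ is an essential singularity, that is, if the limit at $\infty$ does not exist. Two such functions $f, g$ permute if $f \circ g = g \circ f$, in the sense that for every $z \in \widehat{\mathbb{C}}$ either $f(g(z)) = g(f(z))$ or both sides are undefined. A function $f$ meromorphic in $\mathbb{C}$ is minimally permuting if the functions meromorphic in $\mathbb{C}$ that permute with $f$ are exactly $f$ itself and the identity map. There exist transcendental meromorphic functions that are minimally permuting. Specifically, the function $f(z) = \dfrac{e^z}{z} + z$ (with $f(0) = \infty$) is transcendental meromorphic and minimally permuting. -/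

import Mathlib

open Filter Topology OnePoint

namespace PermutableMeromorphic

/-- `f : ℂ → ℂ ∪ {∞}` is meromorphic in the plane: it is the sphere-valued map attached to a
meromorphic function `u`, taking at every point `z` the limit of `u` at `z` (so `∞` exactly at
the poles). The constant `∞` is not included. -/
def IsMeromorphicInPlane (f : ℂ → OnePoint ℂ) : Prop :=
  ∃ u : ℂ → ℂ, Meromorphic u ∧
    ∀ z : ℂ, Tendsto (fun w : ℂ => (u w : OnePoint ℂ)) (𝓝[≠] z) (𝓝 (f z))

/-- The value of `f` at the point `∞`: it is defined when `f` has a limit in the sphere at `∞`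
(that is, when `∞` is a removable singularity or a pole), and is then that limit. -/
noncomputable def valueAtInfty (f : ℂ → OnePoint ℂ) : Part (OnePoint ℂ) where
  Dom := ∃ a : OnePoint ℂ, Tendsto f (cocompact ℂ) (𝓝 a)
  get h := h.choose

theorem mem_valueAtInfty (f : ℂ → OnePoint ℂ) (a : OnePoint ℂ) :
    a ∈ valueAtInfty f ↔ Tendsto f (cocompact ℂ) (𝓝 a) := by
  constructor
  · rintro ⟨h, rfl⟩
    exact h.choose_spec
  · intro ha
    have h : ∃ a : OnePoint ℂ, Tendsto f (cocompact ℂ) (𝓝 a) := ⟨a, ha⟩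
    exact ⟨h, tendsto_nhds_unique h.choose_spec ha⟩

/-- A meromorphic function in the plane as a partial function on the sphere: it is defined on
all of `ℂ`, and also at `∞` unless `∞` is an essential singularity. -/
noncomputable def toSphere (f : ℂ → OnePoint ℂ) : OnePoint ℂ →. OnePoint ℂ :=
  fun z => z.elim (valueAtInfty f) (fun w => Part.some (f w))

/-- `f ∘ g = g ∘ f` as partial functions on the sphere: at each point of `ℂ ∪ {∞}` the two
composites are both defined and equal, or both undefined. -/
def Permutes (f g : ℂ → OnePoint ℂ) : Prop :=
  (toSphere f).comp (toSphere g) = (toSphere g).comp (toSphere f)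

/-- Meromorphic in the plane, with an essential singularity at `∞` (no limit in the sphere). -/
def IsTranscendentalMeromorphic (f : ℂ → OnePoint ℂ) : Prop :=
  IsMeromorphicInPlane f ∧ ¬ ∃ a : OnePoint ℂ, Tendsto f (cocompact ℂ) (𝓝 a)

/-- `f` is meromorphic in the plane and, among all functions meromorphic in the plane, the ones
that permute with `f` are exactly `f` itself and the identity. -/
def IsMinimallyPermuting (f : ℂ → OnePoint ℂ) : Prop :=
  IsMeromorphicInPlane f ∧
    ∀ g : ℂ → OnePoint ℂ, IsMeromorphicInPlane g →
      (Permutes f g ↔ g = f ∨ g = fun z : ℂ => (z : OnePoint ℂ))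

end PermutableMeromorphic

namespace PermutableMeromorphic

open Complex Bornology

/-! Write f for `expQuot`, and let g permute with f. The only pole of f is 0, and f has no value at
∞. For z ≠ 0 the value g(f(z)) is defined, so f(g(z)) is too and g(z) ≠ ∞; thus g can have a pole
only at 0. Comparing the composites at 0 and at ∞ leaves two cases (`Permutes.eq_infty_or_eq_zero`):
g(0) = ∞, or g(0) = 0 and g tends to ∞ at ∞. Both use the local inverse ψ(w) ~ 1/w of f near its
pole, which gives g(w) = f(g(ψ(w))) for large w.

Pole of order m at 0 (`eq_expQuot_of_pole`): g and f have the same zeros, and commutation matches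
the multiplicities up to the factor m, so g = f^m e^h with h entire. Hence f^m e^h = f ∘ G near ∞,
where G = g ∘ ψ ~ c w^m. On circles where |f| ≥ 1 this bounds Re h by a multiple of R^m, so h is a
polynomial of degree at most m. Since log|f(z)| grows like max(Re z, 0) along rays, comparing
leading terms forces m = 1 and c = ±1; finer asymptotics on one real half-line exclude c = -1 and
give g = f when c = 1.

Zero of order d at 0 (`eq_id_of_zero`): g = k z^d, and the relation through ψ gives k a finite limit
at ∞. By Liouville k is constant, equal to ±1, and evaluation at z = 1 leaves only the identity.

Transcendence: f has zeros of arbitrarily large modulus, yet f(z) ~ z on the negative axis. -/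

/-! ### Entire functions: logarithms and growth of the real part -/

/-- A zero-free entire function is the exponential of an entire function. -/
theorem exists_entire_log {q : ℂ → ℂ} (hq : Differentiable ℂ q) (h0 : ∀ z, q z ≠ 0) :
    ∃ h : ℂ → ℂ, Differentiable ℂ h ∧ ∀ z, q z = exp (h z) := by
  have hd : Differentiable ℂ (deriv q) := hq.contDiff.differentiable_deriv_two
  obtain ⟨F, hF⟩ := (hd.div hq h0).isExactOn_univ
  have hF' : ∀ z, HasDerivAt F (deriv q z / q z) z := fun z => by simpa using hF z (Set.mem_univ z)
  have key : ∀ z, q z * exp (-F z) = q 0 * exp (-F 0) := by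
    refine fun z => is_const_of_deriv_eq_zero (f := fun z => q z * exp (-F z)) ?_ ?_ z 0
    · exact hq.mul (fun z => ((hF' z).neg.cexp).differentiableAt)
    · intro z
      have := ((hq z).hasDerivAt.mul ((hF' z).neg.cexp)).deriv
      refine this.trans ?_
      have := h0 z
      field_simp
      ring
  obtain ⟨b, hb⟩ : ∃ b, exp b = q 0 * exp (-F 0) :=
    ⟨_, exp_log (mul_ne_zero (h0 0) (exp_ne_zero _))⟩
  refine ⟨fun z => F z + b, fun z => ((hF' z).add_const b).differentiableAt, fun z => ?_⟩
  rw [exp_add, hb, ← key z, exp_neg]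
  field_simp [exp_ne_zero]

/-- An entire function whose real part is at most `C * R ^ m` on circles of arbitrarily large
radius `R` is a polynomial of degree at most `m`. -/
theorem eq_sum_pow_of_re_le {h : ℂ → ℂ} (hh : Differentiable ℂ h) (m : ℕ) {C : ℝ} (hC : 0 < C)
    (hre : ∀ R₀ : ℝ, ∃ R ≥ R₀, ∀ z, ‖z‖ = R → (h z).re ≤ C * R ^ m) :
    ∃ a : ℕ → ℂ, ∀ z, h z = ∑ i ∈ Finset.range (m + 1), a i * z ^ i := by
  have hvanish : ∀ n, m + 1 ≤ n → iteratedDeriv n h 0 = 0 := by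
    intro n hn
    by_contra hne
    have hpos : 0 < ‖iteratedDeriv n h 0‖ := norm_pos_iff.mpr hne
    -- Cauchy's estimate on the circle of radius R/2 bounds the derivative by K R^m / R^n ≤ K / R; R
    -- is chosen beyond the point where this is a contradiction.
    set K : ℝ := n.factorial * (2 * C + 3 * ‖h 0‖) * 2 ^ n with hK
    obtain ⟨R, hR, hb⟩ := hre (max 1 (K / ‖iteratedDeriv n h 0‖ + 1))
    have hR1 : 1 ≤ R := (le_max_left _ _).trans hR
    have hRK : K / ‖iteratedDeriv n h 0‖ < R := by
      have := (le_max_right _ _).trans hR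
      linarith
    have hR0 : 0 < R := by linarith
    -- The maximum principle for e^h carries the bound on Re h from the circle to the disc, as
    -- Borel–Carathéodory requires.
    have hball : ∀ z ∈ Metric.ball (0 : ℂ) R, (h z).re ≤ C * R ^ m := by
      intro z hz
      have := Complex.norm_le_of_forall_mem_frontier_norm_le (f := fun z => exp (h z))
        (C := Real.exp (C * R ^ m)) (z := z) Metric.isBounded_ball
        (hh.cexp.diffContOnCl) (fun w hw => ?_) (subset_closure hz)
      · simpa [norm_exp] using this
      · rw [frontier_ball _ hR0.ne'] at hw
        rw [norm_exp]
        exact Real.exp_le_exp.mpr (hb w (by simpa using hw))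
    have hhalf : ∀ z ∈ Metric.sphere (0 : ℂ) (R / 2), ‖h z‖ ≤ (2 * C + 3 * ‖h 0‖) * R ^ m := by
      intro z hz
      have hz' : ‖z‖ = R / 2 := by simpa using hz
      have := borelCaratheodory (f := h) (M := C * R ^ m) (R := R) (z := z) (by positivity)
        hh.differentiableOn hball hR0 (by simp [hz']; linarith)
      rw [hz'] at this
      have e : 2 * (C * R ^ m) * (R / 2) / (R - R / 2) + ‖h 0‖ * (R + R / 2) / (R - R / 2)
          = 2 * C * R ^ m + 3 * ‖h 0‖ := by
        have : R - R / 2 ≠ 0 := by linarith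
        field_simp
        ring
      have h1 : 1 ≤ R ^ m := one_le_pow₀ hR1
      have := norm_nonneg (h 0)
      nlinarith
    have hcau := norm_iteratedDeriv_le_of_forall_mem_sphere_norm_le n (half_pos hR0)
      hh.diffContOnCl hhalf
    have hle : R ^ m * R ≤ R ^ n := by
      rw [← pow_succ]; exact pow_le_pow_right₀ hR1 hn
    have : ‖iteratedDeriv n h 0‖ ≤ K / R := by
      refine hcau.trans ?_
      rw [div_pow, hK, div_div_eq_mul_div, div_le_div_iff₀ (by positivity) hR0]
      have : 0 ≤ n.factorial * (2 * C + 3 * ‖h 0‖) * 2 ^ n := by positivity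
      nlinarith
    rw [div_lt_iff₀ hpos] at hRK
    rw [le_div_iff₀ hR0] at this
    linarith
  refine ⟨fun i => (i.factorial : ℂ)⁻¹ * iteratedDeriv i h 0, fun z => ?_⟩
  have hs := hasSum_taylorSeries_of_entire hh 0 z
  rw [hs.unique (hasSum_sum_of_ne_finset_zero (s := Finset.range (m + 1)) ?_)]
  · refine Finset.sum_congr rfl fun i _ => ?_
    simp only [smul_eq_mul, sub_zero]
    ring
  · intro i hi
    rw [hvanish i (by simpa using hi)]
    simp

/-! ### The function e^z/z + z: lower bounds, local inverse at the pole -/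

/-- The function `z ↦ e ^ z / z + z`. -/
noncomputable def expQuot (z : ℂ) : ℂ := exp z / z + z

/-- The entire function `z ↦ e ^ z + z ^ 2`, which is `z * expQuot z` off the origin. -/
noncomputable def expSq (z : ℂ) : ℂ := exp z + z ^ 2

theorem expQuot_eq {z : ℂ} (hz : z ≠ 0) : expQuot z = expSq z / z := by
  unfold expQuot expSq
  field_simp

theorem expSq_zero : expSq 0 = 1 := by simp [expSq]

theorem differentiable_expSq : Differentiable ℂ expSq := by
  unfold expSq; fun_prop

theorem differentiableAt_expQuot {z : ℂ} (hz : z ≠ 0) : DifferentiableAt ℂ expQuot z := by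
  unfold expQuot
  exact (differentiable_exp.differentiableAt.div differentiableAt_id hz).add differentiableAt_id

/-- Take R an odd multiple of π. For Re w ≤ 0 the term w² dominates, and for Re w ≥ √R the
exponential does. In between, |Im w| is within 1 of R, so cos(Im w) ≤ 0: the two terms have real
parts of the same sign and cannot cancel. -/
theorem exists_le_norm_expSq_on_sphere (R₀ : ℝ) :
    ∃ R ≥ R₀, ∀ w : ℂ, ‖w‖ = R → R ≤ ‖expSq w‖ := by
  obtain ⟨k, hk⟩ := exists_nat_ge (max R₀ 2000)
  have hπ := Real.pi_gt_three
  set R : ℝ := (2 * k + 1) * Real.pi with hR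
  have hk1 : R₀ ≤ k := (le_max_left _ _).trans hk
  have hk2 : (2000 : ℝ) ≤ k := (le_max_right _ _).trans hk
  have hkR : (k : ℝ) ≤ R := by nlinarith
  refine ⟨R, hk1.trans hkR, fun w hw => ?_⟩
  have hR2 : (2000 : ℝ) ≤ R := hk2.trans hkR
  have hsq : w.re ^ 2 + w.im ^ 2 = R ^ 2 := by
    rw [← hw, Complex.sq_norm, normSq_apply]; ring
  have hn2 : ‖w ^ 2‖ = R ^ 2 := by rw [norm_pow, hw]
  rcases le_or_gt w.re 0 with hx | hx
  · have h1 : ‖exp w‖ ≤ 1 := by rw [norm_exp]; exact Real.exp_le_one_iff.mpr hx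
    have h2 : ‖w ^ 2‖ ≤ ‖expSq w‖ + ‖exp w‖ := by
      have := norm_sub_le (expSq w) (exp w)
      simpa [expSq] using this
    nlinarith
  rcases le_or_gt (Real.sqrt R) w.re with hx' | hx'
  · have h1 : R ^ 2 + R ≤ ‖exp w‖ := by
      rw [norm_exp]
      have h3 := Real.pow_div_factorial_le_exp (Real.sqrt R) (Real.sqrt_nonneg _) 6
      have h4 : Real.sqrt R ^ 6 = R ^ 3 := by
        rw [show 6 = 2 * 3 from rfl, pow_mul, Real.sq_sqrt (by linarith)]
      rw [h4] at h3
      have h5 := Real.exp_le_exp.mpr hx'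
      have h6 : ((Nat.factorial 6 : ℕ) : ℝ) = 720 := by norm_num [Nat.factorial]
      rw [h6] at h3
      have : R ^ 2 + R ≤ R ^ 3 / 720 := by
        rw [le_div_iff₀ (by norm_num)]
        nlinarith [mul_nonneg (by linarith : 0 ≤ R) (by linarith : 0 ≤ R - 2000)]
      linarith
    have h2 : ‖exp w‖ ≤ ‖expSq w‖ + ‖w ^ 2‖ := by
      have := norm_sub_le (expSq w) (w ^ 2)
      simpa [expSq] using this
    linarith
  · have hxR : w.re ^ 2 < R := by
      have := Real.sq_sqrt (by linarith : 0 ≤ R)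
      nlinarith
    have hy0 := abs_nonneg w.im
    have hy2 : |w.im| ^ 2 = w.im ^ 2 := sq_abs _
    have hyR : |w.im| ≤ R := by
      nlinarith [sq_nonneg w.re]
    have hδ : R - |w.im| < 1 := by
      by_contra hcon
      push Not at hcon
      nlinarith
    have hcos : Real.cos w.im ≤ 0 := by
      rw [← Real.cos_abs, show |w.im| = (Real.pi - (R - |w.im|)) + k * (2 * Real.pi) by
        rw [hR]; ring, Real.cos_add_nat_mul_two_pi, Real.cos_pi_sub]
      have := Real.cos_nonneg_of_neg_pi_div_two_le_of_le (x := R - |w.im|)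
        (by linarith) (by linarith)
      linarith
    have hre : (expSq w).re ≤ -R := by
      have : (expSq w).re = Real.exp w.re * Real.cos w.im + (w.re ^ 2 - w.im ^ 2) := by
        simp [expSq, exp_re, pow_two]
      rw [this]
      have := mul_nonpos_of_nonneg_of_nonpos (Real.exp_pos w.re).le hcos
      nlinarith
    have := neg_le_of_abs_le (abs_re_le_norm (expSq w))
    linarith

/-- A right inverse of `expQuot` near `∞` with values near the pole `0`. -/
theorem exists_expQuot_rightInverse : ∃ ψ : ℂ → ℂ, Tendsto ψ (cobounded ℂ) (𝓝 0) ∧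
    (∀ᶠ w in cobounded ℂ, ψ w ≠ 0 ∧ expQuot (ψ w) = w) ∧
    Tendsto (fun w => w * ψ w) (cobounded ℂ) (𝓝 1) := by
  -- This quotient is 1/f off the origin, with derivative 1 at 0. Its local inverse evaluated at 1/w
  -- is the required ψ(w).
  have han : AnalyticAt ℂ (fun z => z / expSq z) 0 := by
    refine analyticAt_id.div (differentiable_expSq.analyticAt 0) ?_
    simp [expSq_zero]
  have hder : deriv (fun z => z / expSq z) 0 = 1 := by
    have := (hasDerivAt_id (0 : ℂ)).div (differentiable_expSq 0).hasDerivAt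
      (by simp [expSq_zero])
    rw [show (fun z => z / expSq z) = id / expSq from rfl, this.deriv]
    simp [expSq_zero]
  have hstr := han.hasStrictDerivAt
  rw [hder] at hstr
  set ρ := hstr.localInverse _ _ _ one_ne_zero with hρ
  have hρr := hstr.eventually_right_inverse one_ne_zero
  have hρ0 : Tendsto ρ (𝓝 0) (𝓝 0) := by
    have := (hstr.hasStrictFDerivAt_equiv one_ne_zero).localInverse_tendsto
    simpa using this
  simp only [zero_div] at hρr
  have hinv : Tendsto (fun w : ℂ => w⁻¹) (cobounded ℂ) (𝓝 0) := tendsto_inv₀_cobounded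
  have hne : ∀ᶠ w : ℂ in cobounded ℂ, w ≠ 0 := eventually_ne_cobounded 0
  have hev : ∀ᶠ w in cobounded ℂ, ρ w⁻¹ ≠ 0 ∧ expQuot (ρ w⁻¹) = w := by
    filter_upwards [hinv.eventually hρr, hne] with w hw hw0
    have h1 : ρ w⁻¹ / expSq (ρ w⁻¹) = w⁻¹ := hw
    have h2 : ρ w⁻¹ ≠ 0 := by
      intro h; rw [h, zero_div] at h1; exact inv_ne_zero hw0 h1.symm
    refine ⟨h2, ?_⟩
    rw [expQuot_eq h2, ← inv_div, h1, inv_inv]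
  refine ⟨fun w => ρ w⁻¹, hρ0.comp hinv, hev, ?_⟩
  have hp : Tendsto (fun w => expSq (ρ w⁻¹)) (cobounded ℂ) (𝓝 1) := by
    have := (differentiable_expSq.continuous.tendsto 0).comp (hρ0.comp hinv)
    rwa [expSq_zero] at this
  refine hp.congr' ?_
  filter_upwards [hev] with w hw
  nth_rewrite 2 [← hw.2]
  rw [expQuot_eq hw.1, div_mul_cancel₀ _ hw.1]

theorem norm_expQuot_le {z : ℂ} (hz : 1 ≤ ‖z‖) : ‖expQuot z‖ ≤ 2 * Real.exp ‖z‖ := by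
  have h1 : ‖exp z / z‖ ≤ Real.exp ‖z‖ := by
    rw [norm_div, norm_exp]
    calc Real.exp z.re / ‖z‖ ≤ Real.exp z.re := div_le_self (Real.exp_pos _).le hz
      _ ≤ _ := Real.exp_le_exp.mpr (re_le_norm z)
  have h2 : ‖z‖ ≤ Real.exp ‖z‖ := by linarith [Real.add_one_le_exp ‖z‖]
  unfold expQuot
  linarith [norm_add_le (exp z / z) z]

theorem tendsto_expQuot_div_self {ι : Type*} {l : Filter ι} {ζ : ι → ℂ}
    (h : Tendsto (fun t => (ζ t).re) l atBot) :
    Tendsto (fun t => expQuot (ζ t) / ζ t) l (𝓝 1) := by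
  have hcob : Tendsto ζ l (cobounded ℂ) := by
    rw [← tendsto_norm_atTop_iff_cobounded]
    exact tendsto_atTop_mono (fun t => abs_re_le_norm (ζ t)) (tendsto_abs_atBot_atTop.comp h)
  have h1 : Tendsto (fun t => exp (ζ t)) l (𝓝 0) := by
    rw [tendsto_zero_iff_norm_tendsto_zero]
    simp only [norm_exp]
    exact Real.tendsto_exp_atBot.comp h
  have h2 : Tendsto (fun t => (ζ t)⁻¹) l (𝓝 0) := tendsto_inv₀_cobounded.comp hcob
  have h3 : Tendsto (fun t => 1 + exp (ζ t) * ((ζ t)⁻¹) ^ 2) l (𝓝 1) := by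
    simpa using (h1.mul (h2.pow 2)).const_add 1
  refine h3.congr' ?_
  filter_upwards [hcob.eventually (eventually_ne_cobounded 0)] with t ht
  unfold expQuot
  field_simp
  ring

/-! ### Logarithmic growth of e^z/z + z along curves -/

section Growth

variable {ι : Type*} {l : Filter ι} {T : ι → ℝ} {ζ : ι → ℂ} {a : ℂ}

theorem tendsto_log_norm_div_zero (hT : Tendsto T l atTop)
    (hζ : Tendsto (fun t => ζ t / (T t : ℂ)) l (𝓝 a)) (ha : a ≠ 0) :
    Tendsto (fun t => Real.log ‖ζ t‖ / T t) l (𝓝 0) := by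
  have h1 : Tendsto (fun t => Real.log ‖ζ t / (T t : ℂ)‖ / T t) l (𝓝 0) :=
    (hζ.norm.log (norm_ne_zero_iff.mpr ha)).div_atTop hT
  have h2 : Tendsto (fun t => Real.log (T t) / T t) l (𝓝 0) :=
    (Real.isLittleO_log_id_atTop.tendsto_div_nhds_zero).comp hT
  have h3 := h1.add h2
  rw [add_zero] at h3
  refine h3.congr' ?_
  filter_upwards [hT.eventually_gt_atTop 0, hζ.eventually_ne ha] with t ht hne
  have hz : ζ t ≠ 0 := by rintro h; simp [h] at hne
  rw [norm_div, Real.log_div (norm_ne_zero_iff.mpr hz) (by simp [ht.ne']), norm_real,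
    Real.norm_eq_abs, abs_of_pos ht]
  ring

/-- When Re a > 0 the term e^ζ/ζ dominates and log|ζ| = o(T); when Re a < 0 the term ζ dominates and
contributes only log|ζ| = o(T). On Re a = 0 neither term need dominate. -/
theorem tendsto_log_norm_expQuot_div (hT : Tendsto T l atTop)
    (hζ : Tendsto (fun t => ζ t / (T t : ℂ)) l (𝓝 a)) (ha : a.re ≠ 0) :
    (∀ᶠ t in l, expQuot (ζ t) ≠ 0) ∧
      Tendsto (fun t => Real.log ‖expQuot (ζ t)‖ / T t) l (𝓝 (max a.re 0)) := by
  have ha0 : a ≠ 0 := by rintro rfl; simp at ha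
  have hlog := tendsto_log_norm_div_zero hT hζ ha0
  have hre : Tendsto (fun t => (ζ t).re / T t) l (𝓝 a.re) := by
    simpa [Function.comp_def] using (continuous_re.tendsto a).comp hζ
  have hTpos := hT.eventually_gt_atTop 0
  have hζne : ∀ᶠ t in l, ζ t ≠ 0 := by
    filter_upwards [hζ.eventually_ne ha0] with t hne h
    simp [h] at hne
  have hone : ∀ {X : ι → ℂ}, Tendsto X l (𝓝 1) →
      Tendsto (fun t => Real.log ‖X t‖ / T t) l (𝓝 0) := fun hX =>
    (hX.norm.log (by simp)).div_atTop hT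
  rcases lt_or_gt_of_ne ha with hneg | hpos
  · have hbot : Tendsto (fun t => (ζ t).re) l atBot := by
      refine (hre.neg_mul_atTop hneg hT).congr' ?_
      filter_upwards [hTpos] with t ht
      field_simp
    have hX := tendsto_expQuot_div_self hbot
    have hXne := hX.eventually_ne one_ne_zero
    refine ⟨?_, ?_⟩
    · filter_upwards [hXne] with t ht h
      simp [h] at ht
    · rw [max_eq_right hneg.le, ← add_zero (0 : ℝ)]
      refine ((hone hX).add hlog).congr' ?_
      filter_upwards [hXne, hζne] with t ht hz
      have : expQuot (ζ t) ≠ 0 := by intro h; simp [h] at ht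
      rw [norm_div, Real.log_div (norm_ne_zero_iff.mpr this) (norm_ne_zero_iff.mpr hz)]
      ring
  · have hexp : Tendsto (fun t => ((T t : ℂ)) ^ 2 * exp (-ζ t)) l (𝓝 0) := by
      have h0 : Tendsto (fun t => T t ^ 2 * Real.exp (-(a.re / 2) * T t)) l (𝓝 0) := by
        have := (tendsto_rpow_mul_exp_neg_mul_atTop_nhds_zero 2 (a.re / 2) (by linarith)).comp hT
        simpa [Function.comp_def] using this
      refine squeeze_zero_norm' ?_ h0
      filter_upwards [hTpos, hre.eventually (lt_mem_nhds (half_lt_self hpos))] with t ht hlt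
      rw [norm_mul, norm_pow, norm_real, Real.norm_eq_abs, sq_abs, norm_exp]
      rw [lt_div_iff₀ ht] at hlt
      gcongr
      rw [neg_re]
      linarith
    have hX : Tendsto (fun t => 1 + ζ t ^ 2 * exp (-ζ t)) l (𝓝 1) := by
      have h1 := ((hζ.pow 2).mul hexp).const_add 1
      rw [mul_zero, add_zero] at h1
      refine h1.congr' ?_
      filter_upwards [hTpos] with t ht
      have : (T t : ℂ) ≠ 0 := by exact_mod_cast ht.ne'
      field_simp
    have hXne := hX.eventually_ne one_ne_zero
    have heq : ∀ᶠ t in l, expQuot (ζ t) = exp (ζ t) / ζ t * (1 + ζ t ^ 2 * exp (-ζ t)) := by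
      filter_upwards [hζne] with t hz
      unfold expQuot
      rw [exp_neg]
      have := exp_ne_zero (ζ t)
      field_simp
    refine ⟨?_, ?_⟩
    · filter_upwards [hXne, heq, hζne] with t h1 h2 h3
      rw [h2]
      exact mul_ne_zero (div_ne_zero (exp_ne_zero _) h3) h1
    · rw [max_eq_left hpos.le]
      have h3 := (hre.sub hlog).add (hone hX)
      rw [sub_zero, add_zero] at h3
      refine h3.congr' ?_
      filter_upwards [hXne, heq, hζne] with t h1 h2 h3
      rw [h2, norm_mul, norm_div, norm_exp,
        Real.log_mul (div_ne_zero (Real.exp_ne_zero _) (norm_ne_zero_iff.mpr h3))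
          (norm_ne_zero_iff.mpr h1),
        Real.log_div (Real.exp_ne_zero _) (norm_ne_zero_iff.mpr h3), Real.log_exp]
      ring

end Growth

theorem tendsto_ofReal_mul_cobounded {u : ℂ} (hu : u ≠ 0) :
    Tendsto (fun t : ℝ => (t : ℂ) * u) atTop (cobounded ℂ) := by
  rw [← tendsto_norm_atTop_iff_cobounded]
  have : Tendsto (fun t : ℝ => |t| * ‖u‖) atTop atTop :=
    tendsto_abs_atTop_atTop.atTop_mul_const (norm_pos_iff.mpr hu)
  simpa using this

theorem tendsto_sum_pow_div_pow (a : ℕ → ℂ) (m : ℕ) (u : ℂ) :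
    Tendsto (fun t : ℝ => (∑ i ∈ Finset.range (m + 1), a i * ((t : ℂ) * u) ^ i) / (t : ℂ) ^ m)
      atTop (𝓝 (a m * u ^ m)) := by
  have h1 : ∀ i ∈ Finset.range m,
      Tendsto (fun t : ℝ => a i * u ^ i * ((t ^ i / t ^ m : ℝ) : ℂ)) atTop (𝓝 0) := by
    intro i hi
    have := (continuous_ofReal.tendsto 0).comp
      (tendsto_pow_div_pow_atTop_zero (𝕜 := ℝ) (Finset.mem_range.mp hi))
    simpa using this.const_mul (a i * u ^ i)
  have h2 := (tendsto_finsetSum _ h1).add_const (a m * u ^ m)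
  rw [Finset.sum_const_zero, zero_add] at h2
  refine h2.congr' ?_
  filter_upwards [eventually_gt_atTop 0] with t ht
  have : (t : ℂ) ≠ 0 := by exact_mod_cast ht.ne'
  rw [Finset.sum_range_succ, add_div, Finset.sum_div]
  congr 1
  · refine Finset.sum_congr rfl fun i _ => ?_
    push_cast
    rw [mul_pow]
    ring
  · rw [mul_pow]
    field_simp

/-! ### The functional equation and its consequences near ∞ -/

/-- If `v` has a pole of order `m` at `0`, the same zeros as `expQuot`, and commutes with
`expQuot` where both composites are finite, then `v / expQuot ^ m` extends to a zero-free entire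
function. -/
theorem exists_eq_expQuot_pow_mul_exp {v k : ℂ → ℂ} {m : ℕ} (hm : m ≠ 0)
    (hk : Differentiable ℂ k) (hk0 : k 0 ≠ 0) (hv : ∀ z ≠ 0, v z = k z / z ^ m)
    (hzero : ∀ z ≠ 0, (v z = 0 ↔ expQuot z = 0))
    (hcomm : ∀ z ≠ 0, expQuot z ≠ 0 → expQuot (v z) = v (expQuot z)) :
    ∃ h : ℂ → ℂ, Differentiable ℂ h ∧ ∀ z ≠ 0, v z = expQuot z ^ m * exp (h z) := by
  classical
  have hQ : ∀ z ≠ 0, (expQuot z = 0 ↔ expSq z = 0) := fun z hz => by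
    rw [expQuot_eq hz, div_eq_zero_iff, or_iff_left hz]
  -- The value at zeros of `expSq` is the limit there: commutation rewrites v/f^m near such a zero
  -- as expSq(v)/k(f), which is holomorphic and equals 1/k(0) at the zero.
  set q : ℂ → ℂ := fun z => if expSq z = 0 then (k 0)⁻¹ else k z / expSq z ^ m with hq
  have hqd : Differentiable ℂ q := by
    intro z₀
    by_cases hz : expSq z₀ = 0
    · have hz0 : z₀ ≠ 0 := by rintro rfl; simp [expSq_zero] at hz
      have hf0 : expQuot z₀ = 0 := (hQ z₀ hz0).mpr hz
      have hne : ∀ᶠ z in 𝓝 z₀, z ≠ 0 := eventually_ne_nhds hz0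
      have hvd : DifferentiableAt ℂ v z₀ :=
        ((hk z₀).div (differentiableAt_id.pow m) (pow_ne_zero m hz0)).congr_of_eventuallyEq
          (hne.mono fun z h => by simp [hv z h])
      have hfd := differentiableAt_expQuot hz0
      have hkf : DifferentiableAt ℂ (fun z => k (expQuot z)) z₀ := (hk _).comp z₀ hfd
      have hkne : k (expQuot z₀) ≠ 0 := by rwa [hf0]
      have hd : DifferentiableAt ℂ (fun z => expSq (v z) / k (expQuot z)) z₀ :=
        ((differentiable_expSq _).comp z₀ hvd).div hkf hkne
      refine hd.congr_of_eventuallyEq ?_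
      filter_upwards [hne, hkf.continuousAt.eventually_ne hkne] with z hz1 hz2
      by_cases hz3 : expSq z = 0
      · have h1 := (hQ z hz1).mpr hz3
        have h2 := (hzero z hz1).mpr h1
        simp [hq, hz3, h1, h2, expSq_zero]
      · have h1 : expQuot z ≠ 0 := fun h => hz3 ((hQ z hz1).mp h)
        have h2 : v z ≠ 0 := fun h => h1 ((hzero z hz1).mp h)
        have h3 := hcomm z hz1 h1
        rw [hv _ h1, expQuot_eq h2, div_eq_iff h2] at h3
        simp only [hq, hz3, if_false]
        rw [h3, hv z hz1, expQuot_eq hz1, div_pow]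
        rw [expQuot_eq hz1] at hz2
        field_simp
    · have hne : ∀ᶠ z in 𝓝 z₀, expSq z ≠ 0 :=
        differentiable_expSq.continuous.continuousAt.eventually_ne hz
      exact ((hk z₀).div ((differentiable_expSq z₀).pow m) (pow_ne_zero m hz)).congr_of_eventuallyEq
        (hne.mono fun z h => by simp [hq, h])
  have hq0 : ∀ z, q z ≠ 0 := by
    intro z
    by_cases hz : expSq z = 0
    · simp [hq, hz, hk0]
    · simp only [hq, hz, if_false]
      refine div_ne_zero ?_ (pow_ne_zero m hz)
      rcases eq_or_ne z 0 with rfl | hz0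
      · exact hk0
      · intro h
        exact hz ((hQ z hz0).mp ((hzero z hz0).mp (by simp [hv z hz0, h])))
  obtain ⟨h, hh, hqh⟩ := exists_entire_log hqd hq0
  refine ⟨h, hh, fun z hz => ?_⟩
  by_cases hs : expSq z = 0
  · have h1 := (hQ z hz).mpr hs
    rw [(hzero z hz).mpr h1, h1]
    simp [hm]
  · rw [← hqh, expQuot_eq hz, hv z hz, div_pow]
    simp only [hq, hs, if_false]
    field_simp

/-- Near `∞`, a function commuting with `expQuot` factors through `expQuot`. -/
theorem exists_eventually_eq_expQuot_comp {v : ℂ → ℂ}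
    (hcomm : ∀ z ≠ 0, expQuot z ≠ 0 → expQuot (v z) = v (expQuot z)) :
    ∃ ψ : ℂ → ℂ, Tendsto ψ (cobounded ℂ) (𝓝 0) ∧ (∀ᶠ w in cobounded ℂ, ψ w ≠ 0) ∧
      Tendsto (fun w => w * ψ w) (cobounded ℂ) (𝓝 1) ∧
      ∀ᶠ w in cobounded ℂ, v w = expQuot (v (ψ w)) := by
  obtain ⟨ψ, h0, hψ, h1⟩ := exists_expQuot_rightInverse
  refine ⟨ψ, h0, hψ.mono fun w h => h.1, h1, ?_⟩
  filter_upwards [hψ, eventually_ne_cobounded 0] with w hw hw0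
  rw [hcomm _ hw.1 (by rwa [hw.2]), hw.2]

theorem exists_le_forall_of_eventually_cobounded {P : ℂ → Prop} (h : ∀ᶠ w in cobounded ℂ, P w) :
    ∃ r : ℝ, ∀ w : ℂ, r ≤ ‖w‖ → P w := by
  obtain ⟨r, -, hr⟩ := (hasBasis_cobounded_norm (E := ℂ)).eventually_iff.mp h
  exact ⟨r, fun w hw => hr hw⟩

/-- If `expQuot ^ m * exp h = expQuot ∘ G` near `∞`, where `G w ~ c * w ^ m`, then the entire
function `h` is a polynomial of degree at most `m`. -/
theorem eq_sum_pow_of_expQuot_pow_mul_exp_eq {h G : ℂ → ℂ} {c : ℂ} {m : ℕ} (hm : m ≠ 0)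
    (hc : c ≠ 0) (hh : Differentiable ℂ h)
    (hG : Tendsto (fun w => G w / w ^ m) (cobounded ℂ) (𝓝 c))
    (heq : ∀ᶠ w in cobounded ℂ, expQuot w ^ m * exp (h w) = expQuot (G w)) :
    ∃ a : ℕ → ℂ, ∀ z, h z = ∑ i ∈ Finset.range (m + 1), a i * z ^ i := by
  have hcpos : 0 < ‖c‖ := norm_pos_iff.mpr hc
  have hpow : Tendsto (fun w : ℂ => ‖w‖ ^ m) (cobounded ℂ) atTop :=
    (tendsto_pow_atTop hm).comp tendsto_norm_cobounded_atTop
  have hGev : ∀ᶠ w in cobounded ℂ, 1 ≤ ‖G w‖ ∧ ‖G w‖ ≤ (‖c‖ + 1) * ‖w‖ ^ m := by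
    filter_upwards [hG.norm.eventually (lt_mem_nhds (half_lt_self hcpos)),
      hG.norm.eventually (gt_mem_nhds (lt_add_one ‖c‖)), hpow.eventually_ge_atTop (2 / ‖c‖),
      hpow.eventually_gt_atTop 0] with w h1 h2 h3 h4
    rw [norm_div, norm_pow] at h1 h2
    rw [lt_div_iff₀ h4] at h1
    rw [div_lt_iff₀ h4] at h2
    rw [div_le_iff₀ hcpos] at h3
    exact ⟨by nlinarith, h2.le⟩
  obtain ⟨r, hr⟩ := exists_le_forall_of_eventually_cobounded (hGev.and heq)
  refine eq_sum_pow_of_re_le hh m (C := ‖c‖ + 2) (by positivity) fun R₀ => ?_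
  obtain ⟨R, hR, hs⟩ := exists_le_norm_expSq_on_sphere (max (max R₀ r) 1)
  have hR1 : 1 ≤ R := (le_max_right _ _).trans hR
  refine ⟨R, ((le_max_left _ _).trans (le_max_left _ _)).trans hR, fun z hz => ?_⟩
  obtain ⟨⟨h1, h2⟩, h3⟩ :=
    hr z (by rw [hz]; exact ((le_max_right _ _).trans (le_max_left _ _)).trans hR)
  have hz0 : z ≠ 0 := by rw [← norm_pos_iff, hz]; linarith
  have hf : 1 ≤ ‖expQuot z‖ := by
    rw [expQuot_eq hz0, norm_div, hz, one_le_div (by linarith)]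
    exact hs z hz
  have h4 : Real.exp (h z).re ≤ Real.exp (1 + (‖c‖ + 1) * R ^ m) := by
    calc Real.exp (h z).re ≤ ‖expQuot z‖ ^ m * Real.exp (h z).re :=
          le_mul_of_one_le_left (Real.exp_pos _).le (one_le_pow₀ hf)
      _ = ‖expQuot (G z)‖ := by rw [← h3, norm_mul, norm_pow, norm_exp]
      _ ≤ 2 * Real.exp ‖G z‖ := norm_expQuot_le h1
      _ ≤ Real.exp 1 * Real.exp ((‖c‖ + 1) * R ^ m) := by
          rw [hz] at h2
          gcongr
          linarith [Real.add_one_le_exp (1 : ℝ)]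
      _ = _ := (Real.exp_add _ _).symm
  have h5 := Real.exp_le_exp.mp h4
  have h6 : 1 ≤ R ^ m := one_le_pow₀ hR1
  linarith

/-! ### Comparison of leading terms along rays -/

section Rays

variable {h G : ℂ → ℂ} {a : ℕ → ℂ} {c : ℂ} {m : ℕ}

theorem tendsto_comp_ray_div {u : ℂ} (hu : u ≠ 0)
    (hG : Tendsto (fun w => G w / w ^ m) (cobounded ℂ) (𝓝 c)) :
    Tendsto (fun t : ℝ => G (t * u) / ((t ^ m : ℝ) : ℂ)) atTop (𝓝 (c * u ^ m)) := by
  have h1 := (hG.comp (tendsto_ofReal_mul_cobounded hu)).mul_const (u ^ m)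
  refine h1.congr' ?_
  filter_upwards [eventually_gt_atTop 0] with t ht
  have : (t : ℂ) ≠ 0 := by exact_mod_cast ht.ne'
  simp only [Function.comp_apply]
  push_cast
  rw [mul_pow]
  field_simp

theorem tendsto_re_ray_div (hh : ∀ z, h z = ∑ i ∈ Finset.range (m + 1), a i * z ^ i) (u : ℂ) :
    Tendsto (fun t : ℝ => (h (t * u)).re / t ^ m) atTop (𝓝 (a m * u ^ m).re) := by
  have h1 := (continuous_re.tendsto _).comp (tendsto_sum_pow_div_pow a m u)
  refine h1.congr fun t => ?_
  simp only [Function.comp_apply]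
  rw [← hh, ← ofReal_pow, div_ofReal_re]

/-- The exponent `m` in `expQuot ^ m * exp h = expQuot ∘ G` is `1`. -/
theorem eq_one_of_expQuot_pow_mul_exp_eq (hm : m ≠ 0) (hc : c ≠ 0)
    (hG : Tendsto (fun w => G w / w ^ m) (cobounded ℂ) (𝓝 c))
    (heq : ∀ᶠ w in cobounded ℂ, expQuot w ^ m * exp (h w) = expQuot (G w))
    (hh : ∀ z, h z = ∑ i ∈ Finset.range (m + 1), a i * z ^ i) : m = 1 := by
  by_contra hm1
  have hm2 : 1 < m := by omega
  -- For m > 1 the factor f^m contributes at most O(t) to the logarithm, which is negligible against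
  -- t^m.
  have key : ∀ u : ℂ, (c * u ^ m).re ≠ 0 → max (c * u ^ m).re 0 ≤ (a m * u ^ m).re := by
    intro u hu'
    have hu : u ≠ 0 := by rintro rfl; simp [hm] at hu'
    have hray := tendsto_ofReal_mul_cobounded hu
    obtain ⟨hne, hlim⟩ := tendsto_log_norm_expQuot_div (tendsto_pow_atTop hm)
      (tendsto_comp_ray_div hu hG) hu'
    have h1 : Tendsto (fun t : ℝ => m * (Real.log 2 / t ^ m + t ^ 1 / t ^ m * ‖u‖)
        + (h (t * u)).re / t ^ m) atTop (𝓝 (m * (0 + 0 * ‖u‖) + (a m * u ^ m).re)) :=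
      (((tendsto_const_nhds.div_atTop (tendsto_pow_atTop hm)).add
        ((tendsto_pow_div_pow_atTop_zero hm2).mul_const _)).const_mul _).add
        (tendsto_re_ray_div hh u)
    rw [zero_mul, add_zero, mul_zero, zero_add] at h1
    refine le_of_tendsto_of_tendsto hlim h1 ?_
    filter_upwards [hne, hray.eventually heq, eventually_gt_atTop 0,
      (tendsto_norm_cobounded_atTop.comp hray).eventually_ge_atTop 1] with t h2 h3 h4 h5
    have h6 : ‖expQuot (t * u)‖ ≤ Real.exp (Real.log 2 + t * ‖u‖) := by
      have := norm_expQuot_le h5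
      rw [Real.exp_add, Real.exp_log two_pos]
      simpa [abs_of_pos h4] using this
    have h7 : Real.log ‖expQuot (G (t * u))‖ ≤ m * (Real.log 2 + t * ‖u‖) + (h (t * u)).re := by
      rw [Real.log_le_iff_le_exp (norm_pos_iff.mpr h2), ← h3, norm_mul, norm_pow, norm_exp,
        Real.exp_add, Real.exp_nat_mul]
      gcongr
    calc _ ≤ (m * (Real.log 2 + t * ‖u‖) + (h (t * u)).re) / t ^ m := by gcongr
      _ = _ := by ring
  have hcpos : 0 < ‖c‖ := norm_pos_iff.mpr hc
  -- The directions satisfy c u^m = |c| and c u'^m = -|c|. Since u'^m = -u^m, the right side of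
  -- `key` changes sign, while it would have to be positive at u and nonnegative at u'.
  obtain ⟨u, hu⟩ := IsAlgClosed.exists_pow_nat_eq ((‖c‖ : ℂ) / c) (Nat.pos_of_ne_zero hm)
  obtain ⟨u', hu'⟩ := IsAlgClosed.exists_pow_nat_eq (-((‖c‖ : ℂ) / c)) (Nat.pos_of_ne_zero hm)
  have e1 : c * u ^ m = (‖c‖ : ℂ) := by rw [hu]; field_simp
  have e2 : c * u' ^ m = -(‖c‖ : ℂ) := by rw [hu']; field_simp
  have k1 := key u (by rw [e1]; simp [hc])
  have k2 := key u' (by rw [e2]; simp [hc])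
  rw [e1, hu] at k1
  rw [e2, hu'] at k2
  rw [ofReal_re] at k1
  have k3 := (le_max_left _ _).trans k1
  have k4 := (le_max_right _ _).trans k2
  rw [mul_neg, neg_re] at k4
  linarith

theorem max_re_eq_of_expQuot_mul_exp_eq
    (hG : Tendsto (fun w => G w / w ^ 1) (cobounded ℂ) (𝓝 c))
    (heq : ∀ᶠ w in cobounded ℂ, expQuot w ^ 1 * exp (h w) = expQuot (G w))
    (hh : ∀ z, h z = ∑ i ∈ Finset.range (1 + 1), a i * z ^ i) {u : ℂ} (hu : u.re ≠ 0)
    (hcu : (c * u).re ≠ 0) : max (c * u).re 0 = max u.re 0 + (a 1 * u).re := by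
  have hu0 : u ≠ 0 := by rintro rfl; simp at hu
  have hray := tendsto_ofReal_mul_cobounded hu0
  have hT := tendsto_pow_atTop (α := ℝ) one_ne_zero
  obtain ⟨hne, hlim⟩ := tendsto_log_norm_expQuot_div hT (tendsto_comp_ray_div hu0 hG)
    (by simpa using hcu)
  have hid : Tendsto (fun t : ℝ => ((t : ℂ) * u) / ((t ^ 1 : ℝ) : ℂ)) atTop (𝓝 u) := by
    refine tendsto_const_nhds.congr' ?_
    filter_upwards [eventually_gt_atTop 0] with t ht
    have : (t : ℂ) ≠ 0 := by exact_mod_cast ht.ne'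
    rw [pow_one]
    field_simp
  obtain ⟨hne', hlim'⟩ := tendsto_log_norm_expQuot_div hT hid hu
  have h1 := hlim'.add (tendsto_re_ray_div hh u)
  have h2 := tendsto_nhds_unique_of_eventuallyEq hlim h1 ?_
  · simpa using h2
  filter_upwards [hne', hray.eventually heq] with t h3 h4
  rw [← h4, pow_one, norm_mul, norm_exp, Real.log_mul (norm_ne_zero_iff.mpr h3)
    (Real.exp_ne_zero _), Real.log_exp, add_div]

end Rays

theorem eq_one_or_eq_neg_one_of_abs_re_mul {c : ℂ} (hc : c ≠ 0)
    (h : ∀ u : ℂ, u.re ≠ 0 → (c * u).re ≠ 0 → |(c * u).re| = |u.re|) : c = 1 ∨ c = -1 := by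
  have him : c.im = 0 := by
    by_contra hy
    -- A direction with real part 1 that multiplication by c sends to real part 2.
    have e : (c * (1 + ((c.re - 2) / c.im : ℝ) * I)).re = 2 := by
      simp
      field_simp
      ring
    have := h (1 + ((c.re - 2) / c.im : ℝ) * I) (by simp) (by rw [e]; norm_num)
    rw [e] at this
    simp at this
  have hre : c.re ≠ 0 := fun h0 => hc (Complex.ext h0 him)
  have h1 := h 1 (by simp) (by simpa using hre)
  simp only [mul_one, one_re, abs_one] at h1
  rcases (abs_eq zero_le_one).mp h1 with h2 | h2
  · exact Or.inl (Complex.ext h2 (by simpa using him))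
  · exact Or.inr (Complex.ext (by simpa using h2) (by simpa using him))

/-! ### The two cases: pole at 0, zero at 0 -/

/-- A function with a pole at `0` that commutes with `expQuot` is `expQuot`. -/
theorem eq_expQuot_of_pole {v k : ℂ → ℂ} {m : ℕ} (hm : m ≠ 0) (hk : Differentiable ℂ k)
    (hk0 : k 0 ≠ 0) (hv : ∀ z ≠ 0, v z = k z / z ^ m)
    (hzero : ∀ z ≠ 0, (v z = 0 ↔ expQuot z = 0))
    (hcomm : ∀ z ≠ 0, expQuot z ≠ 0 → expQuot (v z) = v (expQuot z)) :
    ∀ z ≠ 0, v z = expQuot z := by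
  obtain ⟨h, hh, hvh⟩ := exists_eq_expQuot_pow_mul_exp hm hk hk0 hv hzero hcomm
  obtain ⟨ψ, hψ0, hψne, hψ1, hψ⟩ := exists_eventually_eq_expQuot_comp hcomm
  have hG : Tendsto (fun w => v (ψ w) / w ^ m) (cobounded ℂ) (𝓝 (k 0)) := by
    have h1 := ((hk.continuous.tendsto 0).comp hψ0).div (hψ1.pow m) (by simp)
    rw [one_pow, div_one] at h1
    refine h1.congr' ?_
    filter_upwards [hψne] with w hw
    change k (ψ w) / (w * ψ w) ^ m = _
    rw [hv _ hw, mul_pow, div_div, mul_comm (w ^ m)]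
  have heq : ∀ᶠ w in cobounded ℂ, expQuot w ^ m * exp (h w) = expQuot (v (ψ w)) := by
    filter_upwards [hψ, eventually_ne_cobounded 0] with w h1 h2
    rw [← h1, hvh w h2]
  obtain ⟨a, ha⟩ := eq_sum_pow_of_expQuot_pow_mul_exp_eq hm hk0 hh hG heq
  obtain rfl := eq_one_of_expQuot_pow_mul_exp_eq hm hk0 hG heq ha
  have key := fun u hu => max_re_eq_of_expQuot_mul_exp_eq (u := u) hG heq ha hu
  -- Adding the identities for u and -u cancels the linear term and leaves |Re(cu)| = |Re u|.
  have hpm : k 0 = 1 ∨ k 0 = -1 := by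
    refine eq_one_or_eq_neg_one_of_abs_re_mul hk0 fun u hu hcu => ?_
    have h1 := key u hu hcu
    have h2 := key (-u) (by simpa using hu) (by rwa [mul_neg, neg_re, neg_ne_zero])
    simp only [mul_neg, neg_re] at h2
    rw [← max_zero_add_max_neg_zero_eq_abs_self, ← max_zero_add_max_neg_zero_eq_abs_self u.re]
    linarith
  have hlin : ∀ z, h z = a 0 + a 1 * z := fun z => by simp [ha z, Finset.sum_range_succ]
  rcases hpm with hc | hc
  · have k1 := key 1 (by simp) (by simp [hc])
    have k2 := key (1 + I) (by simp) (by simp [hc])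
    simp [hc] at k1 k2
    have ha1 : a 1 = 0 := Complex.ext k1 (by simp; linarith)
    have hv' : ∀ z ≠ 0, v z = expQuot z * exp (a 0) := fun z hz => by
      rw [hvh z hz, hlin, ha1, zero_mul, add_zero, pow_one]
    -- On the negative axis G(w) ~ w and f(z) ~ z, so f(G(w))/w tends to 1, while the same quotient
    -- tends to e^(a 0).
    suffices exp (a 0) = 1 by
      intro z hz
      rw [hv' z hz, this, mul_one]
    have hray := tendsto_ofReal_mul_cobounded (u := -1) (by simp)
    have hGt := hG.comp hray
    rw [hc] at hGt
    have hbot : Tendsto (fun t : ℝ => ((t : ℂ) * (-1)).re) atTop atBot := by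
      simpa using tendsto_neg_atTop_atBot
    have hGre : Tendsto (fun t : ℝ => (v (ψ ((t : ℂ) * (-1)))).re) atTop atBot := by
      have h1 := (continuous_re.tendsto _).comp (tendsto_comp_ray_div (u := -1) (by simp) hG)
      have h2 := h1.neg_mul_atTop (by simp [hc]) tendsto_id
      refine h2.congr' ?_
      filter_upwards [eventually_gt_atTop 0] with t ht
      simp only [Function.comp_apply, pow_one, div_ofReal_re, id_eq]
      field_simp
    have h1 := (tendsto_expQuot_div_self hGre).mul hGt
    have h2 := (tendsto_expQuot_div_self hbot).mul_const (exp (a 0))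
    rw [one_mul] at h1 h2
    refine tendsto_nhds_unique_of_eventuallyEq h2 h1 ?_
    filter_upwards [hray.eventually hψ, hray.eventually (eventually_ne_cobounded 0),
      hGre.eventually_lt_atBot 0] with t h3 h4 h5
    have h6 : v (ψ ((t : ℂ) * (-1))) ≠ 0 := by intro h; rw [h, zero_re] at h5; exact h5.false
    simp only [Function.comp_apply]
    rw [pow_one, div_mul_div_comm, mul_comm (v _), mul_div_mul_right _ _ h6, ← h3, hv' _ h4]
    ring
  · exfalso
    have k1 := key 1 (by simp) (by simp [hc])
    have k2 := key (1 + I) (by simp) (by simp [hc])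
    simp [hc] at k1 k2
    have ha1 : a 1 = -1 := Complex.ext (by simp; linarith) (by simp; linarith)
    -- On the positive axis G(t) ~ -t gives f(G(t))/t → -1, whereas this formula makes v(t)/t tend
    -- to 0.
    have hv' : ∀ z ≠ 0, v z = expQuot z * exp (a 0 - z) := fun z hz => by
      rw [hvh z hz, hlin, ha1, pow_one]
      ring_nf
    have hray := tendsto_ofReal_mul_cobounded (u := 1) (by simp)
    have hGt := hG.comp hray
    rw [hc] at hGt
    have hGre : Tendsto (fun t : ℝ => (v (ψ ((t : ℂ) * 1))).re) atTop atBot := by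
      have h1 := (continuous_re.tendsto _).comp (tendsto_comp_ray_div (u := 1) (by simp) hG)
      have h2 := h1.neg_mul_atTop (by simp [hc]) tendsto_id
      refine h2.congr' ?_
      filter_upwards [eventually_gt_atTop 0] with t ht
      simp only [Function.comp_apply, pow_one, div_ofReal_re, id_eq]
      field_simp
    have h1 := (tendsto_expQuot_div_self hGre).mul hGt
    have h2 : Tendsto (fun t : ℝ => (((t : ℂ) * 1)⁻¹ ^ 2 + exp (-t)) * exp (a 0)) atTop
        (𝓝 ((0 ^ 2 + 0) * exp (a 0))) := by
      refine (((tendsto_inv₀_cobounded.comp hray).pow 2).add ?_).mul_const _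
      have := (continuous_ofReal.tendsto 0).comp Real.tendsto_exp_neg_atTop_nhds_zero
      simpa [Function.comp_def] using this
    have h0 := tendsto_nhds_unique_of_eventuallyEq h2 h1 ?_
    · simp at h0
    filter_upwards [hray.eventually hψ, hray.eventually (eventually_ne_cobounded 0),
      hGre.eventually_lt_atBot 0] with t h3 h4 h5
    have h6 : v (ψ ((t : ℂ) * 1)) ≠ 0 := by intro h; rw [h, zero_re] at h5; exact h5.false
    simp only [Function.comp_apply]
    rw [pow_one, div_mul_div_comm, mul_comm (v _), mul_div_mul_right _ _ h6, ← h3, hv' _ h4]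
    unfold expQuot
    rw [mul_one] at h4 ⊢
    rw [sub_eq_add_neg, exp_add, exp_neg]
    have := exp_ne_zero (t : ℂ)
    field_simp

/-- An entire function that commutes with `expQuot` and vanishes at `0` to a finite order `d ≠ 0` is
the identity. -/
theorem eq_id_of_zero {v k : ℂ → ℂ} {d : ℕ} (hd : d ≠ 0) (hk : Differentiable ℂ k)
    (hk0 : k 0 ≠ 0) (hv : ∀ z ≠ 0, v z = k z * z ^ d)
    (hcomm : ∀ z ≠ 0, expQuot z ≠ 0 → expQuot (v z) = v (expQuot z)) :
    ∀ z ≠ 0, v z = z := by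
  obtain ⟨ψ, hψ0, hψne, hψ1, hψ⟩ := exists_eventually_eq_expQuot_comp hcomm
  have hkψ : Tendsto (fun w => k (ψ w)) (cobounded ℂ) (𝓝 (k 0)) :=
    (hk.continuous.tendsto 0).comp hψ0
  have hG : Tendsto (fun w => w ^ d * v (ψ w)) (cobounded ℂ) (𝓝 (k 0)) := by
    have h1 := hkψ.mul (hψ1.pow d)
    rw [one_pow, mul_one] at h1
    refine h1.congr' ?_
    filter_upwards [hψne] with w hw
    rw [hv _ hw]
    ring
  have hG0 : Tendsto (fun w => v (ψ w)) (cobounded ℂ) (𝓝 0) := by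
    have h1 := hkψ.mul (hψ0.pow d)
    rw [zero_pow hd, mul_zero] at h1
    refine h1.congr' ?_
    filter_upwards [hψne] with w hw
    rw [hv _ hw]
  -- For large w, k(w) = expSq(v(ψ(w))) / (w^d v(ψ(w))), with numerator tending to 1 and denominator
  -- to k(0).
  have hlim : Tendsto k (cobounded ℂ) (𝓝 (k 0)⁻¹) := by
    have h1 := ((differentiable_expSq.continuous.tendsto 0).comp hG0).div hG hk0
    rw [expSq_zero, one_div] at h1
    refine h1.congr' ?_
    filter_upwards [hψ, eventually_ne_cobounded 0, hG.eventually_ne hk0] with w h2 h3 h4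
    have h5 : v (ψ w) ≠ 0 := fun h => h4 (by rw [h, mul_zero])
    rw [hv _ h3, expQuot_eq h5] at h2
    change expSq (v (ψ w)) / (w ^ d * v (ψ w)) = k w
    rw [mul_comm, ← div_div, ← h2]
    field_simp
  have hconst : ∀ z, k z = (k 0)⁻¹ := fun z =>
    hk.apply_eq_of_tendsto_cocompact z (by rwa [← Metric.cobounded_eq_cocompact])
  have hsq : k 0 = 1 ∨ k 0 = -1 := by
    have h1 := mul_inv_cancel₀ hk0
    rw [← hconst 0] at h1
    exact mul_self_eq_one_iff.mp h1
  -- Commutation at z = 1 reads f(±1) = ±f(1)^d. The plus sign gives d = 1; the minus sign would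
  -- need e⁻¹ + 1 = (e + 1)^d, which is too large.
  have he : expQuot 1 = ((Real.exp 1 + 1 : ℝ) : ℂ) := by simp [expQuot]
  have hene : expQuot 1 ≠ 0 := by
    rw [he]; exact_mod_cast (by positivity : Real.exp 1 + 1 ≠ 0)
  have h1 := hcomm 1 one_ne_zero hene
  rw [hv _ hene, hv _ one_ne_zero, hconst 1, hconst (expQuot 1), one_pow, mul_one] at h1
  have hE : 1 < Real.exp 1 + 1 := by linarith [Real.exp_pos 1]
  rcases hsq with hc | hc
  · rw [hc, inv_one, one_mul, he] at h1
    have h2 : (Real.exp 1 + 1) ^ 1 = (Real.exp 1 + 1) ^ d := by rw [pow_one]; exact_mod_cast h1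
    obtain rfl := (pow_right_injective₀ (by linarith) hE.ne') h2
    intro z hz
    rw [hv z hz, hconst, hc, inv_one, one_mul, pow_one]
  · exfalso
    rw [hc, he] at h1
    have e2 : expQuot (-1)⁻¹ = ((-(Real.exp (-1) + 1) : ℝ) : ℂ) := by
      simp [expQuot, exp_neg]
      ring
    rw [e2] at h1
    have h2 : Real.exp (-1) + 1 = (Real.exp 1 + 1) ^ d := by
      have : -(Real.exp (-1) + 1) = (-1)⁻¹ * (Real.exp 1 + 1) ^ d := by
        apply ofReal_injective
        rw [h1]
        push_cast
        rfl
      norm_num at this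
      linarith
    have h3 := le_self_pow₀ hE.le hd
    have h4 : Real.exp (-1) < Real.exp 1 := Real.exp_lt_exp.mpr (by norm_num)
    linarith

/-! ### Zeros of e^z/z + z -/

/-- `expQuot` has zeros of arbitrarily large modulus. They are found on the curve
`|e ^ z| = |z| ^ 2`. -/
theorem exists_expQuot_eq_zero (M : ℝ) : ∃ w : ℂ, M ≤ ‖w‖ ∧ w ≠ 0 ∧ expQuot w = 0 := by
  -- From 12 on, x³/6 ≥ 2x², so e^x ≥ 2x² and the ordinate y(x) is at least x.
  set A : ℝ := max M 12 with hA
  have hA12 : 12 ≤ A := le_max_right _ _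
  have hexp : ∀ x, A ≤ x → 2 * x ^ 2 ≤ Real.exp x := by
    intro x hx
    have h1 := Real.pow_div_factorial_le_exp x (by linarith) 3
    have h2 : ((Nat.factorial 3 : ℕ) : ℝ) = 6 := by norm_num [Nat.factorial]
    rw [h2] at h1
    refine le_trans ?_ h1
    rw [le_div_iff₀ (by norm_num)]
    nlinarith [mul_nonneg (sq_nonneg x) (by linarith : 0 ≤ x - 12)]
  set y : ℝ → ℝ := fun x => Real.sqrt (Real.exp x - x ^ 2) with hy
  set w : ℝ → ℂ := fun x => x + y x * I with hw
  -- On the curve e^w and w² have equal modulus, so e^w = -w² once θ is an odd multiple of π. The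
  -- intermediate value theorem supplies such a point.
  set θ : ℝ → ℝ := fun x => y x - 2 * (w x).arg with hθ
  have hyc : Continuous y := by fun_prop
  have hwc : Continuous w := by fun_prop
  have hwre : ∀ x, (w x).re = x := fun x => by simp [hw]
  have hwim : ∀ x, (w x).im = y x := fun x => by simp [hw]
  have hθc : ContinuousOn θ (Set.Ici A) := by
    refine hyc.continuousOn.sub (continuousOn_const.mul fun x hx => ?_)
    have hx' : A ≤ x := hx
    exact ((continuousAt_arg (Or.inl (by rw [hwre]; linarith))).comp
      hwc.continuousAt).continuousWithinAt
  have hyge : ∀ x, A ≤ x → x ≤ y x := fun x hx =>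
    Real.le_sqrt_of_sq_le (by linarith [hexp x hx])
  obtain ⟨k, hk⟩ := exists_nat_ge (θ A)
  have hπ := Real.pi_gt_three
  -- The extra 2π absorbs the term 2 arg w, since arg w ≤ π.
  set B : ℝ := max A ((2 * k + 3) * Real.pi) with hB
  have hAB : A ≤ B := le_max_left _ _
  have hmem : (2 * k + 1) * Real.pi ∈ Set.Icc (θ A) (θ B) := by
    constructor
    · have : (0 : ℝ) ≤ k := Nat.cast_nonneg k
      nlinarith
    · have h1 := hyge B hAB
      have h2 : (2 * k + 3) * Real.pi ≤ B := le_max_right _ _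
      have h3 := arg_le_pi (w B)
      simp only [hθ]
      linarith
  obtain ⟨x, hx, hxθ⟩ := intermediate_value_Icc hAB (hθc.mono Set.Icc_subset_Ici_self) hmem
  have hxA : A ≤ x := hx.1
  have hw0 : w x ≠ 0 := by
    intro h
    have := hwre x
    rw [h, zero_re] at this
    linarith
  refine ⟨w x, ?_, hw0, ?_⟩
  · calc M ≤ x := (le_max_left _ _).trans hxA
      _ = (w x).re := (hwre x).symm
      _ ≤ ‖w x‖ := re_le_norm _
  have hnorm : ‖w x‖ ^ 2 = Real.exp x := by
    rw [Complex.sq_norm, normSq_apply, hwre, hwim, ← pow_two, ← pow_two,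
      Real.sq_sqrt (by nlinarith [hexp x hxA, sq_nonneg x])]
    ring
  have hyx : y x = 2 * (w x).arg + Real.pi + k * (2 * Real.pi) := by
    simp only [hθ] at hxθ
    linarith
  have hexpw : exp (w x) = -(w x) ^ 2 := by
    have h1 : (w x) ^ 2 = (Real.exp x : ℂ) * exp (2 * ((w x).arg * I)) := by
      conv_lhs => rw [← norm_mul_exp_arg_mul_I (w x)]
      rw [mul_pow, ← ofReal_pow, hnorm, ← exp_nat_mul]
      norm_num
    have h2 : exp (w x) = (Real.exp x : ℂ) * exp (y x * I) := by
      simp only [hw]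
      rw [exp_add, ofReal_exp]
    rw [h2, h1, hyx]
    push_cast
    rw [show (2 * ((w x).arg : ℂ) + Real.pi + k * (2 * Real.pi)) * I =
      2 * ((w x).arg * I) + Real.pi * I + k * (2 * Real.pi * I) by ring, exp_add, exp_add,
      exp_pi_mul_I, exp_nat_mul_two_pi_mul_I]
    ring
  rw [expQuot_eq hw0, expSq, hexpw, neg_add_cancel, zero_div]

/-! ### Sphere-valued functions and their finite parts -/

/-- The sphere-valued meromorphic function `z ↦ e ^ z / z + z`, with its pole at `0`. -/
noncomputable def sphereExpQuot (z : ℂ) : OnePoint ℂ := open Classical in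
  if z = 0 then ∞ else (expQuot z : OnePoint ℂ)

theorem sphereExpQuot_zero : sphereExpQuot 0 = ∞ := by simp [sphereExpQuot]

theorem sphereExpQuot_of_ne {z : ℂ} (hz : z ≠ 0) : sphereExpQuot z = (expQuot z : OnePoint ℂ) := by
  simp [sphereExpQuot, hz]

theorem sphereExpQuot_eq_infty_iff {z : ℂ} : sphereExpQuot z = ∞ ↔ z = 0 := by
  refine ⟨fun h => ?_, fun h => h ▸ sphereExpQuot_zero⟩
  by_contra hz
  rw [sphereExpQuot_of_ne hz] at h
  exact coe_ne_infty _ h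

theorem tendsto_coe_cobounded_infty : Tendsto ((↑) : ℂ → OnePoint ℂ) (cobounded ℂ) (𝓝 ∞) := by
  rw [Metric.cobounded_eq_cocompact, ← coclosedCompact_eq_cocompact]
  exact tendsto_coe_infty

theorem isMeromorphicInPlane_sphereExpQuot : IsMeromorphicInPlane sphereExpQuot := by
  refine ⟨expQuot, fun z => ?_, fun z => ?_⟩
  · have h : AnalyticAt ℂ exp z := differentiable_exp.analyticAt z
    exact (h.meromorphicAt.div (MeromorphicAt.id z)).add (MeromorphicAt.id z)
  · rcases eq_or_ne z 0 with rfl | hz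
    · rw [sphereExpQuot_zero]
      refine tendsto_coe_cobounded_infty.comp ?_
      rw [← tendsto_norm_atTop_iff_cobounded]
      have h1 : Tendsto (fun z => ‖expSq z‖) (𝓝[≠] (0 : ℂ)) (𝓝 1) := by
        have := (differentiable_expSq.continuous.norm.tendsto 0).mono_left
          (nhdsWithin_le_nhds (s := {0}ᶜ))
        simpa [expSq_zero] using this
      have h2 : Tendsto (fun z : ℂ => ‖z⁻¹‖) (𝓝[≠] 0) atTop :=
        tendsto_norm_cobounded_atTop.comp tendsto_inv₀_nhdsNE_zero
      refine (h1.pos_mul_atTop one_pos h2).congr' ?_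
      filter_upwards [self_mem_nhdsWithin] with z hz
      rw [expQuot_eq hz, norm_div, norm_inv, div_eq_mul_inv]
    · rw [sphereExpQuot_of_ne hz]
      exact ((continuous_coe.tendsto _).comp
        (differentiableAt_expQuot hz).continuousAt.tendsto).mono_left nhdsWithin_le_nhds

theorem not_exists_tendsto_sphereExpQuot :
    ¬ ∃ a : OnePoint ℂ, Tendsto sphereExpQuot (cocompact ℂ) (𝓝 a) := by
  rintro ⟨a, ha⟩
  rw [← Metric.cobounded_eq_cocompact] at ha
  have ha0 : a = ((0 : ℂ) : OnePoint ℂ) := by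
    by_contra hne
    obtain ⟨r, hr⟩ := exists_le_forall_of_eventually_cobounded (ha.eventually_ne hne)
    obtain ⟨w, hw, hw0, hwz⟩ := exists_expQuot_eq_zero r
    exact hr w hw (by rw [sphereExpQuot_of_ne hw0, hwz])
  have hray := tendsto_ofReal_mul_cobounded (u := -1) (by simp)
  have h1 : Tendsto (fun t : ℝ => expQuot ((t : ℂ) * (-1))) atTop (𝓝 0) := by
    rw [isOpenEmbedding_coe.isInducing.tendsto_nhds_iff, ← ha0]
    refine (ha.comp hray).congr' ?_
    filter_upwards [hray.eventually (eventually_ne_cobounded 0)] with t ht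
    exact sphereExpQuot_of_ne ht
  have h2 := h1.mul (tendsto_inv₀_cobounded.comp hray)
  have hbot : Tendsto (fun t : ℝ => ((t : ℂ) * (-1)).re) atTop atBot := by
    simpa using tendsto_neg_atTop_atBot
  have h3 := tendsto_nhds_unique h2 (tendsto_expQuot_div_self hbot)
  simp at h3

/-- The value in `ℂ` of a point of the sphere, with `∞` sent to `0`. -/
noncomputable def finitePart (x : OnePoint ℂ) : ℂ := x.elim 0 id

theorem finitePart_coe (z : ℂ) : finitePart (z : OnePoint ℂ) = z := rfl

theorem coe_finitePart {x : OnePoint ℂ} (hx : x ≠ ∞) : (finitePart x : OnePoint ℂ) = x := by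
  obtain ⟨z, rfl⟩ := ne_infty_iff_exists.mp hx
  rfl

section IsMeromorphicInPlane

variable {g : ℂ → OnePoint ℂ}

/-- The given representative u may differ from g at isolated points, but agrees with it wherever u
is analytic. The finite part of g can therefore replace u. -/
theorem IsMeromorphicInPlane.meromorphicAt_finitePart (hg : IsMeromorphicInPlane g) (z : ℂ) :
    MeromorphicAt (fun w => finitePart (g w)) z ∧
      Tendsto (fun w => (finitePart (g w) : OnePoint ℂ)) (𝓝[≠] z) (𝓝 (g z)) := by
  obtain ⟨u, hu, hlim⟩ := hg
  have h : ∀ᶠ w in 𝓝[≠] z, u w = finitePart (g w) := by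
    filter_upwards [(hu z).eventually_analyticAt] with w hw
    have h1 : Tendsto (fun w => (u w : OnePoint ℂ)) (𝓝[≠] w) (𝓝 (u w)) :=
      ((continuous_coe.tendsto _).comp hw.continuousAt.tendsto).mono_left nhdsWithin_le_nhds
    rw [tendsto_nhds_unique (hlim w) h1, finitePart_coe]
  exact ⟨(hu z).congr h, (hlim z).congr' (h.mono fun w hw => by rw [hw])⟩

theorem IsMeromorphicInPlane.analyticAt_finitePart (hg : IsMeromorphicInPlane g) {z : ℂ}
    (hz : g z ≠ ∞) : AnalyticAt ℂ (fun w => finitePart (g w)) z := by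
  obtain ⟨hm, hlim⟩ := hg.meromorphicAt_finitePart z
  refine hm.analyticAt ?_
  rw [← coe_finitePart hz] at hlim
  rw [continuousAt_iff_punctured_nhds, isOpenEmbedding_coe.isInducing.tendsto_nhds_iff]
  exact hlim

theorem IsMeromorphicInPlane.meromorphicOrderAt_finitePart_neg (hg : IsMeromorphicInPlane g)
    {z : ℂ} (hz : g z = ∞) : meromorphicOrderAt (fun w => finitePart (g w)) z < 0 := by
  obtain ⟨hm, hlim⟩ := hg.meromorphicAt_finitePart z
  by_contra! hneg
  obtain ⟨c, hc⟩ := tendsto_nhds_of_meromorphicOrderAt_nonneg hm hneg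
  have := tendsto_nhds_unique hlim ((continuous_coe.tendsto c).comp hc)
  rw [hz] at this
  exact infty_ne_coe c this

end IsMeromorphicInPlane

theorem exists_differentiable_extension {v κ : ℂ → ℂ} (hv : ∀ z ≠ 0, DifferentiableAt ℂ v z)
    (hκ : DifferentiableAt ℂ κ 0) (h : ∀ᶠ z in 𝓝[≠] 0, v z = κ z) :
    ∃ k : ℂ → ℂ, Differentiable ℂ k ∧ k 0 = κ 0 ∧ ∀ z ≠ 0, k z = v z := by
  refine ⟨Function.update v 0 (κ 0), fun z => ?_, by simp, fun z hz => by simp [hz]⟩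
  rcases eq_or_ne z 0 with rfl | hz
  · refine hκ.congr_of_eventuallyEq ?_
    rw [eventually_nhdsWithin_iff] at h
    filter_upwards [h] with w hw
    rcases eq_or_ne w 0 with rfl | hw0
    · simp
    · simpa [hw0] using hw hw0
  · refine (hv z hz).congr_of_eventuallyEq ?_
    filter_upwards [eventually_ne_nhds hz] with w hw
    simp [hw]

theorem toSphere_coe (f : ℂ → OnePoint ℂ) (z : ℂ) :
    toSphere f (z : OnePoint ℂ) = Part.some (f z) := rfl

theorem toSphere_infty (f : ℂ → OnePoint ℂ) : toSphere f ∞ = valueAtInfty f := rfl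

theorem valueAtInfty_sphereExpQuot : valueAtInfty sphereExpQuot = Part.none :=
  Part.eq_none_iff'.mpr not_exists_tendsto_sphereExpQuot

/-! ### Functions permuting with e^z/z + z -/

section Permutes

variable {g : ℂ → OnePoint ℂ}

theorem Permutes.toSphere_apply (hp : Permutes sphereExpQuot g) (z : ℂ) :
    toSphere sphereExpQuot (g z) = toSphere g (sphereExpQuot z) := by
  exact (Part.bind_some _ _).symm.trans
    ((congrFun hp (z : OnePoint ℂ)).trans (Part.bind_some _ _))

theorem Permutes.ne_infty (hp : Permutes sphereExpQuot g) {z : ℂ} (hz : z ≠ 0) : g z ≠ ∞ := by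
  intro h
  have := hp.toSphere_apply z
  rw [h, toSphere_infty, valueAtInfty_sphereExpQuot, sphereExpQuot_of_ne hz, toSphere_coe] at this
  exact Part.some_ne_none _ this.symm

theorem Permutes.sphereExpQuot_finitePart (hp : Permutes sphereExpQuot g) {z : ℂ} (hz : z ≠ 0) :
    sphereExpQuot (finitePart (g z)) = g (expQuot z) := by
  have := hp.toSphere_apply z
  rw [← coe_finitePart (hp.ne_infty hz), sphereExpQuot_of_ne hz, toSphere_coe, toSphere_coe] at this
  exact Part.some_injective this

theorem Permutes.expQuot_finitePart (hp : Permutes sphereExpQuot g) {z : ℂ} (hz : z ≠ 0)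
    (hz' : expQuot z ≠ 0) : expQuot (finitePart (g z)) = finitePart (g (expQuot z)) := by
  have h1 := hp.sphereExpQuot_finitePart hz
  have h2 : finitePart (g z) ≠ 0 := by
    intro h
    rw [h, sphereExpQuot_zero] at h1
    exact hp.ne_infty hz' h1.symm
  rw [← h1, sphereExpQuot_of_ne h2, finitePart_coe]

/-- A function permuting with `sphereExpQuot` either has a pole at `0`, or vanishes at `0` and
tends to `∞` at `∞`. -/
theorem Permutes.eq_infty_or_eq_zero (hp : Permutes sphereExpQuot g) :
    g 0 = ∞ ∨ g 0 = ((0 : ℂ) : OnePoint ℂ) ∧ Tendsto g (cocompact ℂ) (𝓝 ∞) := by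
  refine or_iff_not_imp_left.mpr fun h0 => ?_
  obtain ⟨c, hc⟩ := ne_infty_iff_exists.mp h0
  have h1 := hp.toSphere_apply 0
  rw [← hc, toSphere_coe, sphereExpQuot_zero, toSphere_infty] at h1
  have h2 : (valueAtInfty g).bind (toSphere sphereExpQuot) =
      (valueAtInfty sphereExpQuot).bind (toSphere g) := congrFun hp ∞
  rw [valueAtInfty_sphereExpQuot, ← h1] at h2
  replace h2 := (Part.bind_some _ _).symm.trans (h2.trans (Part.bind_none _))
  -- At ∞ the composite g ∘ f is undefined, so f must be undefined at g(∞) = f(c); this happens only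
  -- at ∞.
  have h3 : sphereExpQuot c = ∞ := by
    by_contra hne
    rw [← coe_finitePart hne, toSphere_coe] at h2
    exact Part.some_ne_none _ h2
  rw [h3] at h1
  refine ⟨by rw [← hc, sphereExpQuot_eq_infty_iff.mp h3], ?_⟩
  rw [← mem_valueAtInfty, ← h1]
  exact Part.mem_some _

theorem Permutes.eq_of_infty (hg : IsMeromorphicInPlane g) (hp : Permutes sphereExpQuot g)
    (h0 : g 0 = ∞) : g = sphereExpQuot := by
  set v : ℂ → ℂ := fun z => finitePart (g z) with hv
  have hord : meromorphicOrderAt v 0 < 0 := hg.meromorphicOrderAt_finitePart_neg h0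
  obtain ⟨n, hn⟩ := WithTop.ne_top_iff_exists.mp hord.ne_top
  rw [← hn] at hord
  have hn0 : n < 0 := by exact_mod_cast hord
  obtain ⟨κ, hκ, hκ0, hκv⟩ :=
    (meromorphicOrderAt_eq_int_iff (hg.meromorphicAt_finitePart 0).1).mp hn.symm
  obtain ⟨m, rfl⟩ : ∃ m : ℕ, n = -m := ⟨n.natAbs, by omega⟩
  obtain ⟨k, hk, hk0, hkv⟩ := exists_differentiable_extension (v := fun z => v z * z ^ m)
    (fun z hz => (hg.analyticAt_finitePart (hp.ne_infty hz)).differentiableAt.mul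
      (differentiableAt_id.pow m)) hκ.differentiableAt (by
      filter_upwards [hκv, self_mem_nhdsWithin] with z hz hz0
      have : z ^ m ≠ 0 := pow_ne_zero m hz0
      simp only [hv]
      rw [hz, sub_zero, zpow_neg, zpow_natCast, smul_eq_mul]
      field_simp)
  have key := eq_expQuot_of_pole (v := v) (m := m) (by omega) hk (by rwa [hk0])
    (fun z hz => by rw [hkv z hz]; field_simp)
    -- Both conditions say that f(g(z)) = g(f(z)) is ∞, as f and g have their only pole at 0.
    (fun z hz => by
      rw [← sphereExpQuot_eq_infty_iff, hp.sphereExpQuot_finitePart hz]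
      refine ⟨fun h => ?_, fun h => by rw [h, h0]⟩
      by_contra hne
      exact hp.ne_infty hne h)
    (fun z hz hz' => hp.expQuot_finitePart hz hz')
  funext z
  rcases eq_or_ne z 0 with rfl | hz
  · rw [h0, sphereExpQuot_zero]
  · rw [sphereExpQuot_of_ne hz, ← key z hz, coe_finitePart (hp.ne_infty hz)]

theorem Permutes.eq_of_zero (hg : IsMeromorphicInPlane g) (hp : Permutes sphereExpQuot g)
    (h0 : g 0 = ((0 : ℂ) : OnePoint ℂ)) (hinf : Tendsto g (cocompact ℂ) (𝓝 ∞)) :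
    g = fun z : ℂ => (z : OnePoint ℂ) := by
  set v : ℂ → ℂ := fun z => finitePart (g z) with hv
  have hfin : ∀ z, g z ≠ ∞ := by
    intro z
    rcases eq_or_ne z 0 with rfl | hz
    · rw [h0]; exact coe_ne_infty _
    · exact hp.ne_infty hz
  have han : ∀ z, AnalyticAt ℂ v z := fun z => hg.analyticAt_finitePart (hfin z)
  have hv0 : v 0 = 0 := by simp only [hv]; rw [h0, finitePart_coe]
  -- The limit ∞ at ∞ excludes g ≡ 0, so the order of vanishing at 0 is finite.
  have hnz : ¬ ∀ᶠ z in 𝓝 0, v z = 0 := by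
    intro h
    have hz : v = 0 := AnalyticOnNhd.eq_of_eventuallyEq (fun z _ => han z)
      (fun z _ => analyticAt_const) h
    have hgz : g = fun _ => ((0 : ℂ) : OnePoint ℂ) := by
      funext z
      rw [← coe_finitePart (hfin z)]
      exact congrArg _ (congrFun hz z)
    rw [hgz] at hinf
    exact coe_ne_infty _ (tendsto_nhds_unique tendsto_const_nhds hinf)
  obtain ⟨d, κ, hκ, hκ0, hκv⟩ := (han 0).exists_eventuallyEq_pow_smul_nonzero_iff.mpr hnz
  have hd : d ≠ 0 := by
    rintro rfl
    have := hκv.self_of_nhds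
    rw [hv0] at this
    simp at this
    exact hκ0 this.symm
  obtain ⟨k, hk, hk0, hkv⟩ := exists_differentiable_extension (v := fun z => v z / z ^ d)
    (fun z hz => (han z).differentiableAt.div (differentiableAt_id.pow d) (pow_ne_zero d hz))
    hκ.differentiableAt (by
      filter_upwards [hκv.filter_mono nhdsWithin_le_nhds, self_mem_nhdsWithin] with z hz hz0
      have : z ^ d ≠ 0 := pow_ne_zero d hz0
      rw [hz, sub_zero, smul_eq_mul]
      field_simp)
  have key := eq_id_of_zero (v := v) hd hk (by rwa [hk0])
    (fun z hz => by rw [hkv z hz]; field_simp) (fun z hz hz' => hp.expQuot_finitePart hz hz')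
  funext z
  rcases eq_or_ne z 0 with rfl | hz
  · exact h0
  · rw [← coe_finitePart (hfin z)]
    exact congrArg _ (key z hz)

end Permutes

theorem toSphere_coe_eq_id : toSphere (fun z : ℂ => (z : OnePoint ℂ)) = PFun.id (OnePoint ℂ) := by
  funext x
  induction x using OnePoint.rec with
  | infty =>
    refine Part.eq_some_iff.mpr ((mem_valueAtInfty _ _).mpr ?_)
    rw [← Metric.cobounded_eq_cocompact]
    exact tendsto_coe_cobounded_infty
  | coe z => rfl

theorem permutes_coe (f : ℂ → OnePoint ℂ) : Permutes f (fun z : ℂ => (z : OnePoint ℂ)) := by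
  rw [Permutes, toSphere_coe_eq_id, PFun.comp_id, PFun.id_comp]

theorem isMinimallyPermuting_sphereExpQuot : IsMinimallyPermuting sphereExpQuot := by
  refine ⟨isMeromorphicInPlane_sphereExpQuot, fun g hg => ⟨fun hp => ?_, ?_⟩⟩
  · rcases hp.eq_infty_or_eq_zero with h0 | ⟨h0, hinf⟩
    · exact Or.inl (hp.eq_of_infty hg h0)
    · exact Or.inr (hp.eq_of_zero hg h0 hinf)
  · rintro (rfl | rfl)
    · rfl
    · exact permutes_coe _

end PermutableMeromorphic

theorem theorem1p4 :
    ∃ f : ℂ → OnePoint ℂ,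
      (f 0 = ∞ ∧ ∀ z : ℂ, z ≠ 0 → f z = ((Complex.exp z / z + z : ℂ) : OnePoint ℂ)) ∧
      PermutableMeromorphic.IsTranscendentalMeromorphic f ∧
      PermutableMeromorphic.IsMinimallyPermuting f :=
  ⟨PermutableMeromorphic.sphereExpQuot,
    ⟨PermutableMeromorphic.sphereExpQuot_zero, fun _ hz =>
      PermutableMeromorphic.sphereExpQuot_of_ne hz⟩,
    ⟨PermutableMeromorphic.isMeromorphicInPlane_sphereExpQuot,
      PermutableMeromorphic.not_exists_tendsto_sphereExpQuot⟩,
    PermutableMeromorphic.isMinimallyPermuting_sphereExpQuot⟩
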